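/- For integers $B\ge 1$ and $n\ge 0$, a PCSA summary of $n$ distinct items with $B$ buckets and infinitely many levels is the random bit matrix $S\in\{0,1\}^{\{1,\dots,B\}\times\{1,2,3,\dots\}}$ obtained as follows. The items $x=1,\dots,n$ get i.i.d. hash values $(h_1(x),h_2(x))$, where $h_1(x)$ is uniform on $\{1,\dots,B\}$, $h_2(x)$ is independent of $h_1(x)$, and $\Pr(h_2(x)=j)=2^{-j}$ for $j\ge 1$; and $S_{ij}=1$ if and only if $(h_1(x),h_2(x))=(i,j)$ for some item $x$. A Poissonized summary $\overline S$ (with parameters $B,n$) is a PCSA summary of $N$ distinct items, where $N\sim\mathrm{Poisson}(n)$ is independent of the hash values. An independent-entry summary $\tilde S$ (with parameters $B,n$) is a random bit matrix whose true likelihood is the composite marginal likelihood, i.e. its entries are independent and each entry $\tilde S_{ij}$ has the same law as the corresponding entry of a PCSA summary of $n$ distinct items, namely $\mathrm{Bernoulli}\bigl(1-(1-2^{-j}/B)^n\bigr)$. Let $B(n)\ge 1$ be integers with $B(n)\log B(n)=o(\sqrt n)$ as $n\to\infty$, and for each $n$ let $S_n$ be a PCSA summary of $n$ distinct items with $B(n)$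 buckets and infinitely many levels, all of them defined on one probability space (with arbitrary dependence between different $n$). Then, after possibly enlarging the probability space (that is, on a probability space with a measure-preserving map to the given one, along which the $S_n$ are pulled back), there exist, for every $n$, a Poissonized summary $\overline S_n$ and an independent-entry summary $\tilde S_n$, both with parameters $B(n),n$, such that $$\Pr\bigl(S_n=\tilde S_n=\overline S_n\bigr)\longrightarrow 1\qquad\text{as } n\to\infty .$$ -/

import Mathlib

open MeasureTheory ProbabilityTheory Filter Topology Asymptotics

universe u

/-- The location of a bit: a bucket `i : Fin B` and a level. Levels are numbered from `0` here, so
that `(i, k)` is level `k + 1` in the usual numbering `1, 2, 3, …` of the geometric levels. -/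
abbrev Cell (B : ℕ) : Type := Fin B × ℕ

/-- A bit matrix with `B` buckets and infinitely many levels, with the product `σ`-algebra. -/
abbrev Sketch (B : ℕ) : Type := Cell B → Bool

/-- The PCSA summary of items with hash values `h`: a bit is `1` iff some item hashes to it. -/
noncomputable def pcsa {B n : ℕ} (h : Fin n → Cell B) : Sketch B :=
  open Classical in fun c => decide (∃ x, h x = c)

/-- The law of the hash value of one item: the bucket is uniform, and independently the level is
geometric with parameter `1 / 2`, i.e. `(i, k)` has probability `2⁻¹ ^ (k + 1) / B`. -/
noncomputable def hashLaw (B : ℕ) : Measure (Cell B) :=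
  (uniformOn (Set.univ : Set (Fin B))).prod
    (geometricMeasure ⟨(2 : ℝ)⁻¹, by norm_num, by norm_num⟩)

/-- The law of the PCSA summary of `n` distinct items, whose hash values are i.i.d. -/
noncomputable def pcsaLaw (B n : ℕ) : Measure (Sketch B) :=
  (Measure.pi fun _ : Fin n => hashLaw B).map pcsa

/-- The law of the PCSA summary of `N` distinct items, where `N ∼ Poisson(n)` is independent of
the hash values. -/
noncomputable def poissonPcsaLaw (B n : ℕ) : Measure (Sketch B) :=
  (poissonMeasure (n : NNReal)).bind (pcsaLaw B)

/-- The law whose likelihood is the composite marginal likelihood for `n` items, i.e. the product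
of the marginal likelihoods of the bits of a PCSA summary: the bits are independent, and each one
has the same law as the corresponding bit of the PCSA summary of `n` distinct items
(see `map_eval_pcsaLaw` for this law in closed form). -/
noncomputable def compositeLaw (B n : ℕ) : Measure (Sketch B) :=
  Measure.infinitePi fun c : Cell B => (pcsaLaw B n).map (fun s => s c)

theorem measurable_pcsa {B n : ℕ} : Measurable (pcsa : (Fin n → Cell B) → Sketch B) :=
  measurable_of_countable _

instance isProbabilityMeasure_hashLaw (B : ℕ) [NeZero B] : IsProbabilityMeasure (hashLaw B) := by
  have := isProbabilityMeasure_uniformOn (Set.finite_univ (α := Fin B)) Set.univ_nonempty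
  unfold hashLaw
  infer_instance

instance isProbabilityMeasure_pcsaLaw (B n : ℕ) [NeZero B] :
    IsProbabilityMeasure (pcsaLaw B n) :=
  Measure.isProbabilityMeasure_map measurable_pcsa.aemeasurable

instance isProbabilityMeasure_poissonPcsaLaw (B n : ℕ) [NeZero B] :
    IsProbabilityMeasure (poissonPcsaLaw B n) :=
  isProbabilityMeasure_bind (measurable_of_countable _).aemeasurable
    (Eventually.of_forall fun _ => inferInstance)

instance isProbabilityMeasure_map_eval_pcsaLaw (B n : ℕ) [NeZero B] (c : Cell B) :
    IsProbabilityMeasure ((pcsaLaw B n).map (fun s => s c)) :=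
  Measure.isProbabilityMeasure_map (measurable_pi_apply c).aemeasurable

instance isProbabilityMeasure_compositeLaw (B n : ℕ) [NeZero B] :
    IsProbabilityMeasure (compositeLaw B n) := by
  unfold compositeLaw
  infer_instance

/-- The probability `ρ` that an item is mapped to a given cell. -/
noncomputable def cellProb {B : ℕ} (c : Cell B) : ℝ := (2 : ℝ)⁻¹ ^ (c.2 + 1) / B

theorem cellProb_mem {B : ℕ} (c : Cell B) : cellProb c ∈ unitInterval := by
  unfold cellProb
  have hB : (1 : ℝ) ≤ B := by exact_mod_cast c.1.pos
  refine ⟨by positivity, ?_⟩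
  rw [div_le_one (by positivity)]
  exact (pow_le_one₀ (by norm_num) (by norm_num)).trans hB

theorem hashLaw_real_singleton {B : ℕ} (c : Cell B) :
    (hashLaw B).real {c} = cellProb c := by
  obtain ⟨i, k⟩ := c
  have hg := geometricMeasure_real_singleton
    (p := ⟨(2 : ℝ)⁻¹, by norm_num, by norm_num⟩) (by simp [← unitInterval.coe_ne_zero]) k
  have hu : (uniformOn (Set.univ : Set (Fin B))).real {i} = (B : ℝ)⁻¹ := by
    simp [measureReal_def, uniformOn_univ]
  rw [hashLaw, ← Set.singleton_prod_singleton, measureReal_prod_prod, hg, hu, cellProb]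
  norm_num [pow_succ]
  ring

/-- The bit in cell `c` is `Bernoulli (1 - γ ^ n)` with `γ = 1 - ρ`. -/
theorem map_eval_pcsaLaw (B n : ℕ) (c : Cell B) :
    (pcsaLaw B n).map (fun s => s c) = bernoulliMeasure true false
      ⟨1 - (1 - cellProb c) ^ n, by
        have h := cellProb_mem c
        have h0 : 0 ≤ 1 - cellProb c := by linarith [h.2]
        have h1 : 1 - cellProb c ≤ 1 := by linarith [h.1]
        exact ⟨by linarith [pow_le_one₀ (n := n) h0 h1], by linarith [pow_nonneg h0 n]⟩⟩ := by
  have : NeZero B := ⟨c.1.pos.ne'⟩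
  have hf : ((pcsaLaw B n).map (fun s => s c)).real {false} = (1 - cellProb c) ^ n := by
    have hset : (fun s : Sketch B => s c) ∘ pcsa ⁻¹' {false}
        = Set.univ.pi (fun _ : Fin n => ({c}ᶜ : Set (Cell B))) := by
      ext h
      simp [pcsa]
    rw [pcsaLaw, Measure.map_map (measurable_pi_apply c) measurable_pcsa,
      map_measureReal_apply ((measurable_pi_apply c).comp measurable_pcsa) (by simp), hset,
      measureReal_def, Measure.pi_pi, ENNReal.toReal_prod]
    simp only [← measureReal_def, probReal_compl_eq_one_sub (measurableSet_singleton c),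
      hashLaw_real_singleton]
    simp
  have ht : ((pcsaLaw B n).map (fun s => s c)).real {true} = 1 - (1 - cellProb c) ^ n := by
    rw [← hf, ← probReal_compl_eq_one_sub (by simp)]
    congr 1
    ext b
    simp
  refine Measure.ext_of_measureReal_singleton fun b => ?_
  have hm : MeasurableSet {b} := measurableSet_singleton b
  cases b
  · rw [hf, bernoulliMeasure_real_apply _ hm]
    simp
  · rw [ht, bernoulliMeasure_real_apply _ hm]
    simp

/-! For each `n` a maximal coupling reduces the claim to two total variation bounds between the PCSA
law and another law. Each comparison law has independent bits, the bit at `c` vanishing with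
probability `β c ^ n`, where `1 - ρ ≤ β ≤ exp (-ρ)` and `ρ = cellProb c`: the composite law has `β =
1 - ρ`, the Poissonized one `β = exp (-ρ)`. One argument (`tvLe_pcsaLaw`) covers both.

Cut at a level `j`. Below it all bits are `1` under either law, up to probability `2 B exp (-x)`
with `x = n 2⁻ʲ / B`. From `j` on, an item lands with probability at most `p = 2⁻ʲ`. Its bits there
are within `p ^ 2` of independent bits with vanishing probabilities `β` (`tvLe_map_cellBits`), since
these rarely set two bits at once. Both laws are disjunctions of `n` independent such vectors, so
the errors add up to `n p ^ 2`.

Taking `n 2⁻ʲ` within a factor `2` of `B (log B + M)` makes the first error `O(exp (-M))` and the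
second `O((B (log B + M)) ^ 2 / n)`, which tends to `0` because `B log B = o(√n)`. -/

open scoped ENNReal unitInterval

/-! ### Total variation bounds -/

/-- `μ` exceeds `ν` by at most `ε` on every measurable set. For probability measures this says that
their total variation distance is at most `ε`. -/
def TVLe {X : Type*} [MeasurableSpace X] (μ ν : Measure X) (ε : ℝ≥0∞) : Prop :=
  ∀ A, MeasurableSet A → μ A ≤ ν A + ε

namespace TVLe

theorem mono {X : Type*} [MeasurableSpace X] {μ ν : Measure X} {ε δ : ℝ≥0∞}
    (h : TVLe μ ν ε) (hδ : ε ≤ δ) : TVLe μ ν δ :=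
  fun A hA => (h A hA).trans (by gcongr)

theorem map {X Y : Type*} [MeasurableSpace X] [MeasurableSpace Y] {μ ν : Measure X} {ε : ℝ≥0∞}
    (h : TVLe μ ν ε) {f : X → Y} (hf : Measurable f) : TVLe (μ.map f) (ν.map f) ε := by
  intro A hA
  rw [Measure.map_apply hf hA, Measure.map_apply hf hA]
  exact h _ (hf hA)

/-- The factors are exchanged one at a time, through the intermediate measure `μ.prod ν'`. -/
theorem prod {X Y : Type*} [MeasurableSpace X] [MeasurableSpace Y] {μ ν : Measure X}
    {μ' ν' : Measure Y} [IsProbabilityMeasure μ] [IsProbabilityMeasure ν] [IsProbabilityMeasure μ']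
    [IsProbabilityMeasure ν'] {ε ε' : ℝ≥0∞} (h : TVLe μ ν ε) (h' : TVLe μ' ν' ε') :
    TVLe (μ.prod μ') (ν.prod ν') (ε + ε') := by
  intro A hA
  calc μ.prod μ' A = ∫⁻ x, μ' (Prod.mk x ⁻¹' A) ∂μ := Measure.prod_apply hA
    _ ≤ ∫⁻ x, (ν' (Prod.mk x ⁻¹' A) + ε') ∂μ :=
        lintegral_mono fun x => h' _ (measurable_prodMk_left hA)
    _ = μ.prod ν' A + ε' := by
        rw [lintegral_add_right _ measurable_const, ← Measure.prod_apply hA]; simp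
    _ = ∫⁻ y, μ ((fun x => (x, y)) ⁻¹' A) ∂ν' + ε' := by rw [Measure.prod_apply_symm hA]
    _ ≤ ∫⁻ y, (ν ((fun x => (x, y)) ⁻¹' A) + ε) ∂ν' + ε' := by
        gcongr with y
        exact h _ (measurable_prodMk_right hA)
    _ = ν.prod ν' A + (ε + ε') := by
        rw [lintegral_add_right _ measurable_const, ← Measure.prod_apply_symm hA]
        simp [add_assoc]

theorem pi {X : Type*} [MeasurableSpace X] {μ ν : Measure X} [IsProbabilityMeasure μ]
    [IsProbabilityMeasure ν] {ε : ℝ≥0∞} (h : TVLe μ ν ε) (n : ℕ) :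
    TVLe (Measure.pi fun _ : Fin n => μ) (Measure.pi fun _ : Fin n => ν) (n * ε) := by
  induction n with
  | zero =>
    intro A _
    rw [Measure.pi_of_empty, Measure.pi_of_empty]
    exact le_self_add
  | succ n ih =>
    have e (ξ : Measure X) [IsProbabilityMeasure ξ] :=
      ((measurePreserving_piFinSuccAbove (fun _ : Fin (n + 1) => ξ) 0).symm).map_eq
    rw [← e μ, ← e ν]
    refine ((h.prod ih).map (MeasurableEquiv.measurable _)).mono ?_
    push_cast
    rw [add_mul, one_mul, add_comm]

/-- The mass of `μ ⊓ ν` is the infimum of `μ t + ν tᶜ` over all sets `t`, measurable or not; hence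
the passage to `toMeasurable`. -/
theorem one_le_inf_add {X : Type*} [MeasurableSpace X] {μ ν : Measure X} [IsProbabilityMeasure μ]
    {ε : ℝ≥0∞} (h : TVLe μ ν ε) : 1 ≤ (μ ⊓ ν) Set.univ + ε := by
  rw [Measure.inf_apply MeasurableSet.univ, ← tsub_le_iff_right]
  refine le_sInf ?_
  rintro _ ⟨t, rfl⟩
  rw [tsub_le_iff_right, Set.inter_univ, Set.inter_univ]
  have hm := measurableSet_toMeasurable μ t
  calc (1 : ℝ≥0∞) = μ (toMeasurable μ t) + μ (toMeasurable μ t)ᶜ := by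
        rw [measure_add_measure_compl hm, measure_univ]
    _ ≤ μ t + (ν (toMeasurable μ t)ᶜ + ε) := by
        rw [measure_toMeasurable]
        gcongr
        exact h _ hm.compl
    _ ≤ μ t + ν tᶜ + ε := by
        rw [← add_assoc]
        gcongr
        exact subset_toMeasurable μ t

end TVLe

/-! ### Maximal couplings on an enlarged space -/

/-- A probability measure `ν` can be realised as a function of a `μ`-distributed point and of
independent randomness, so that it agrees with the given point with the largest probability. -/
theorem exists_map_prod_eq {X : Type*} [MeasurableSpace X] (μ ν : Measure X)
    [IsProbabilityMeasure μ] [IsProbabilityMeasure ν] :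
    ∃ (τ : Measure (I × X)) (_ : IsProbabilityMeasure τ) (g : X × (I × X) → X), Measurable g ∧
      (μ.prod τ).map g = ν ∧ (μ.prod τ) {z | g z ≠ z.1} ≤ 1 - (μ ⊓ ν) Set.univ := by
  set m := μ ⊓ ν
  have hmμ : m ≤ μ := inf_le_left
  have hmν : m ≤ ν := inf_le_right
  have : IsFiniteMeasure m := isFiniteMeasure_of_le μ hmμ
  set a := 1 - m Set.univ with ha
  have hares : (ν - m) Set.univ = a := by
    rw [Measure.sub_apply MeasurableSet.univ hmν, measure_univ]
  have ha_top : a ≠ ∞ := ne_top_of_le_ne_top ENNReal.one_ne_top tsub_le_self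
  -- The residual law is `ν - m` normalised. If `a = 0`, the residual is never used and any law
  -- serves.
  obtain ⟨res, hres, hresA⟩ : ∃ res : Measure X, IsProbabilityMeasure res ∧
      ∀ A, MeasurableSet A → a * res A = ν A - m A := by
    by_cases h0 : a = 0
    · refine ⟨ν, inferInstance, fun A hA => ?_⟩
      have : ν - m = 0 := Measure.measure_univ_eq_zero.1 (hares.trans h0)
      rw [h0, zero_mul, ← Measure.sub_apply hA hmν, this]; simp
    · refine ⟨a⁻¹ • (ν - m), ⟨?_⟩, fun A hA => ?_⟩
      · rw [Measure.smul_apply, hares, smul_eq_mul, ENNReal.inv_mul_cancel h0 ha_top]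
      · rw [Measure.smul_apply, Measure.sub_apply hA hmν, smul_eq_mul, ← mul_assoc,
          ENNReal.mul_inv_cancel h0 ha_top, one_mul]
  -- The probability of keeping the given point `x`; a uniform variable in `I` decides, and a
  -- rejected point is replaced by a draw from `res`.
  set f : X → I := fun x => Set.projIcc 0 1 zero_le_one (m.rnDeriv μ x).toReal with hf
  have hfm : Measurable f :=
    continuous_projIcc.measurable.comp (Measure.measurable_rnDeriv m μ).ennreal_toReal
  have hfeq : ∀ᵐ x ∂μ, ENNReal.ofReal (f x) = m.rnDeriv μ x := by
    filter_upwards [Measure.rnDeriv_le_one_of_le hmμ] with x hx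
    have hx1 : (m.rnDeriv μ x).toReal ≤ 1 := by
      simpa using ENNReal.toReal_mono ENNReal.one_ne_top hx
    rw [hf]
    simp only
    rw [Set.projIcc_of_mem zero_le_one ⟨ENNReal.toReal_nonneg, hx1⟩,
      ENNReal.ofReal_toReal (ne_top_of_le_ne_top ENNReal.one_ne_top hx)]
  have hfA : ∀ A, MeasurableSet A → ∫⁻ x in A, ENNReal.ofReal (f x) ∂μ = m A := by
    intro A hA
    rw [setLIntegral_congr_fun_ae hA (g := m.rnDeriv μ) (hfeq.mono fun x hx _ => hx),
      ← withDensity_apply _ hA, Measure.withDensity_rnDeriv_eq _ _ hmμ.absolutelyContinuous]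
  have hvol (x : X) : (volume : Measure I) (Set.Iic (f x))ᶜ = 1 - ENNReal.ofReal (f x) := by
    rw [prob_compl_eq_one_sub measurableSet_Iic]
    congr 1
    exact unitInterval.volume_Iic _
  have hfm' : Measurable fun x => ENNReal.ofReal (f x) :=
    ENNReal.measurable_ofReal.comp (measurable_subtype_coe.comp hfm)
  have hint : ∫⁻ x, (1 - ENNReal.ofReal (f x)) ∂μ = a := by
    rw [lintegral_sub hfm', ← setLIntegral_univ (fun x => ENNReal.ofReal (f x)),
      hfA _ MeasurableSet.univ]
    · simp [ha]
    · rw [← setLIntegral_univ, hfA _ MeasurableSet.univ]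
      exact measure_ne_top _ _
    · filter_upwards with x
      exact ENNReal.ofReal_le_one.2 (f x).2.2
  have hle : MeasurableSet {z : X × (I × X) | z.2.1 ≤ f z.1} :=
    measurableSet_le (by fun_prop) (by fun_prop)
  classical
  refine ⟨volume.prod res, inferInstance, fun z => if z.2.1 ≤ f z.1 then z.1 else z.2.2,
    Measurable.ite hle (by fun_prop) (by fun_prop), ?_, ?_⟩
  · ext A hA
    have hg : Measurable fun z : X × (I × X) => if z.2.1 ≤ f z.1 then z.1 else z.2.2 :=
      Measurable.ite hle (by fun_prop) (by fun_prop)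
    rw [Measure.map_apply hg hA, Measure.prod_apply (hg hA)]
    have hsec (x : X) : (volume.prod res) (Prod.mk x ⁻¹'
        ((fun z : X × (I × X) => if z.2.1 ≤ f z.1 then z.1 else z.2.2) ⁻¹' A)) =
        A.indicator (fun x => ENNReal.ofReal (f x)) x + (1 - ENNReal.ofReal (f x)) * res A := by
      have hsplit : (Prod.mk x ⁻¹'
        ((fun z : X × (I × X) => if z.2.1 ≤ f z.1 then z.1 else z.2.2) ⁻¹' A)) =
        ((Set.Iic (f x)) ×ˢ {_y : X | x ∈ A}) ∪ ((Set.Iic (f x))ᶜ ×ˢ A) := by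
        ext ⟨v, y⟩
        by_cases hv : v ≤ f x
        · simp [hv]
        · simp [hv, not_le.1 hv]
      have hdisj : Disjoint ((Set.Iic (f x)) ×ˢ {_y : X | x ∈ A}) ((Set.Iic (f x))ᶜ ×ˢ A) :=
        Set.Disjoint.set_prod_left disjoint_compl_right _ _
      rw [hsplit, measure_union hdisj (measurableSet_Iic.compl.prod hA), Measure.prod_prod,
        Measure.prod_prod, hvol]
      congr 1
      by_cases hx : x ∈ A
      · simp only [hx, Set.ofPred_true, measure_univ, mul_one, Set.indicator_of_mem]
        exact unitInterval.volume_Iic _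
      · simp [hx]
    simp_rw [hsec]
    rw [lintegral_add_left (hfm'.indicator hA), lintegral_indicator hA, hfA A hA,
      lintegral_mul_const _ (hfm'.const_sub 1), hint, hresA A hA]
    exact add_tsub_cancel_of_le (hmν A)
  · calc (μ.prod (volume.prod res)) {z | (if z.2.1 ≤ f z.1 then z.1 else z.2.2) ≠ z.1}
        ≤ (μ.prod (volume.prod res)) {z | z.2.1 ≤ f z.1}ᶜ := by
          refine measure_mono fun z hz hz' => hz ?_
          exact if_pos hz'
      _ = a := by
          rw [Measure.prod_apply hle.compl, ← hint]
          refine lintegral_congr fun x => ?_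
          have : Prod.mk x ⁻¹' {z : X × (I × X) | z.2.1 ≤ f z.1}ᶜ =
              (Set.Iic (f x))ᶜ ×ˢ Set.univ := by
            ext ⟨v, y⟩
            simp
          rw [this, Measure.prod_prod, hvol, measure_univ, mul_one]

/-- Random elements on a probability space can be coupled, on an enlarged space, to random elements
with prescribed laws, so that each pair differs with at most the total variation distance. -/
theorem exists_enlarged_coupling {ι : Type} {X : ι → Type} [∀ i, MeasurableSpace (X i)]
    {Ω : Type u} [MeasurableSpace Ω] (P : Measure Ω) [IsProbabilityMeasure P]
    (μ ν : ∀ i, Measure (X i)) [∀ i, IsProbabilityMeasure (μ i)] [∀ i, IsProbabilityMeasure (ν i)]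
    (S : ∀ i, Ω → X i) (hS : ∀ i, HasLaw (S i) (μ i) P) :
    ∃ (Ω' : Type u) (_ : MeasurableSpace Ω') (P' : Measure Ω') (_ : IsProbabilityMeasure P')
      (π : Ω' → Ω) (T : ∀ i, Ω' → X i), MeasurePreserving π P' P ∧
      (∀ i, HasLaw (T i) (ν i) P') ∧
      ∀ i ε, TVLe (μ i) (ν i) ε → P' {ω | S i (π ω) ≠ T i ω} ≤ ε := by
  -- Each index gets its own independent auxiliary variable. Only the law of each pair `(S i,
  -- auxiliary i)` matters, so the dependence among the `S i` plays no role.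
  choose τ hτ g hg hlaw hne using fun i => exists_map_prod_eq (μ i) (ν i)
  have hφ (i : ι) : HasLaw (fun ω : Ω × (∀ i, I × X i) => (S i ω.1, ω.2 i))
      ((μ i).prod (τ i)) (P.prod (Measure.infinitePi τ)) := by
    have h1 : HasLaw (fun ω : Ω × (∀ i, I × X i) => S i ω.1) (μ i)
        (P.prod (Measure.infinitePi τ)) := (hS i).comp measurePreserving_fst.hasLaw
    have h2 : HasLaw (fun ω : Ω × (∀ i, I × X i) => ω.2 i) (τ i)
        (P.prod (Measure.infinitePi τ)) :=
      (measurePreserving_eval_infinitePi τ i).hasLaw.comp measurePreserving_snd.hasLaw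
    refine IndepFun.hasLaw_prod h1 h2 ?_
    exact indepFun_prod₀ (hS i).aemeasurable (measurable_pi_apply i).aemeasurable
  refine ⟨Ω × (∀ i, I × X i), inferInstance, P.prod (Measure.infinitePi τ), inferInstance,
    Prod.fst, fun i ω => g i (S i ω.1, ω.2 i), measurePreserving_fst, fun i => ?_, fun i ε h => ?_⟩
  · have : HasLaw (g i) (ν i) ((μ i).prod (τ i)) := ⟨(hg i).aemeasurable, hlaw i⟩
    exact this.comp (hφ i)
  · calc (P.prod (Measure.infinitePi τ)) {ω | S i ω.1 ≠ g i (S i ω.1, ω.2 i)}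
        ≤ (P.prod (Measure.infinitePi τ)).map (fun ω => (S i ω.1, ω.2 i))
            {z | g i z ≠ z.1} := by
          refine le_trans (measure_mono ?_) (Measure.le_map_apply (hφ i).aemeasurable _)
          exact fun ω hω => Ne.symm hω
      _ ≤ 1 - (μ i ⊓ ν i) Set.univ := by
          rw [(hφ i).map_eq]
          exact hne i
      _ ≤ ε := tsub_le_iff_left.2 h.one_le_inf_add

/-! ### Bit vectors and their vanishing probabilities -/

/-- The event that all bits at the locations in `A` are `0`. -/
def clearOn {ι : Type*} (A : Finset ι) : Set (ι → Bool) := {s | ∀ c ∈ A, s c = false}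

theorem clearOn_eq_pi {ι : Type*} (A : Finset ι) :
    clearOn A = Set.pi (A : Set ι) fun _ => {false} := by
  ext s
  simp [clearOn]

theorem measurableSet_clearOn {ι : Type*} (A : Finset ι) : MeasurableSet (clearOn A) := by
  rw [clearOn_eq_pi]
  exact MeasurableSet.pi A.countable_toSet fun _ _ => measurableSet_singleton _

/-- The law of a random bit vector is determined by the probabilities that given finite sets of
bits vanish. -/
theorem ext_of_clearOn {ι : Type*} {μ ν : Measure (ι → Bool)} [IsProbabilityMeasure μ]
    [IsProbabilityMeasure ν] (h : ∀ A : Finset ι, μ (clearOn A) = ν (clearOn A)) : μ = ν := by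
  classical
  -- The events `clearOn A` form a π-system, because intersections correspond to unions of the index
  -- sets.
  refine ext_of_generate_finite (Set.range clearOn) (le_antisymm ?_ ?_) ?_ ?_ (by simp)
  · refine iSup_le fun c => ?_
    rw [← measurable_iff_comap_le]
    have hf : @MeasurableSet _ (MeasurableSpace.generateFrom (Set.range clearOn))
        ((fun s : ι → Bool => s c) ⁻¹' {false}) := by
      refine MeasurableSpace.measurableSet_generateFrom ⟨{c}, ?_⟩
      ext s
      simp [clearOn]
    refine @measurable_to_bool _ (MeasurableSpace.generateFrom (Set.range clearOn)) _ ?_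
    have := hf.compl
    convert this using 1
    ext s
    simp
  · refine MeasurableSpace.generateFrom_le ?_
    rintro _ ⟨A, rfl⟩
    exact measurableSet_clearOn A
  · rintro _ ⟨A, rfl⟩ _ ⟨A', rfl⟩ _
    refine ⟨A ∪ A', ?_⟩
    ext s
    simp only [clearOn, Finset.mem_union, Set.mem_ofPred_eq, Set.mem_inter_iff]
    grind
  · rintro _ ⟨A, rfl⟩
    exact h A

/-- The bitwise disjunction of `n` bit vectors. -/
def bitOr {ι : Type*} {n : ℕ} (h : Fin n → ι → Bool) : ι → Bool :=
  fun c => decide (∃ x, h x c = true)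

theorem measurable_bitOr {ι : Type*} {n : ℕ} :
    Measurable (bitOr : (Fin n → ι → Bool) → ι → Bool) := by
  refine measurable_pi_lambda _ fun c => ?_
  have : (fun h : Fin n → ι → Bool => bitOr h c) =
      (fun g : Fin n → Bool => decide (∃ x, g x = true)) ∘ fun h x => h x c := rfl
  rw [this]
  exact (measurable_of_countable _).comp (by fun_prop)

/-- The law of the bitwise disjunction of `n` independent random bit vectors with law `μ`. -/
noncomputable def orLaw {ι : Type*} (n : ℕ) (μ : Measure (ι → Bool)) : Measure (ι → Bool) :=
  (Measure.pi fun _ : Fin n => μ).map bitOr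

instance isProbabilityMeasure_orLaw {ι : Type*} (n : ℕ) (μ : Measure (ι → Bool))
    [IsProbabilityMeasure μ] : IsProbabilityMeasure (orLaw n μ) :=
  Measure.isProbabilityMeasure_map measurable_bitOr.aemeasurable

theorem orLaw_clearOn {ι : Type*} (n : ℕ) (μ : Measure (ι → Bool)) [IsProbabilityMeasure μ]
    (A : Finset ι) : orLaw n μ (clearOn A) = μ (clearOn A) ^ n := by
  have : bitOr ⁻¹' clearOn A = Set.univ.pi fun _ : Fin n => clearOn A := by
    ext h
    simp only [clearOn, bitOr, Set.mem_preimage, Set.mem_ofPred_eq, Set.mem_univ_pi,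
      decide_eq_false_iff_not, not_exists, Bool.not_eq_true]
    grind
  rw [orLaw, Measure.map_apply measurable_bitOr (measurableSet_clearOn A), this, Measure.pi_pi]
  simp

/-! ### One item against independent bits -/

theorem bernoulliMeasure_false_singleton (b : I) :
    bernoulliMeasure false true b {false} = ENNReal.ofReal b := by
  rw [← ofReal_measureReal, bernoulliMeasure_real_apply _ (measurableSet_singleton _)]
  simp

theorem bernoulliMeasure_true_singleton (b : I) :
    bernoulliMeasure false true b {true} = ENNReal.ofReal (1 - b) := by
  rw [← ofReal_measureReal, bernoulliMeasure_real_apply _ (measurableSet_singleton _)]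
  simp

/-- The law of independent bits, where the bit at `c` vanishes with probability `β c`. -/
noncomputable def bitsLaw {ι : Type*} [Fintype ι] (β : ι → I) : Measure (ι → Bool) :=
  Measure.pi fun c => bernoulliMeasure false true (β c)

instance isProbabilityMeasure_bitsLaw {ι : Type*} [Fintype ι] (β : ι → I) :
    IsProbabilityMeasure (bitsLaw β) := by
  unfold bitsLaw
  infer_instance

theorem bitsLaw_clearOn {ι : Type*} [Fintype ι] (β : ι → I) (A : Finset ι) :
    bitsLaw β (clearOn A) = ∏ c ∈ A, ENNReal.ofReal (β c) := by
  rw [clearOn_eq_pi, bitsLaw, Measure.pi_pi_finset]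
  simp_rw [bernoulliMeasure_false_singleton]

theorem one_sub_sum_le_prod_one_sub {ι : Type*} (s : Finset ι) (ρ : ι → ℝ)
    (hρ : ∀ c, ρ c ∈ Set.Icc 0 1) : 1 - ∑ c ∈ s, ρ c ≤ ∏ c ∈ s, (1 - ρ c) := by
  classical
  induction s using Finset.induction_on with
  | empty => simp
  | insert c s hc ih =>
    rw [Finset.sum_insert hc, Finset.prod_insert hc]
    have h1 := mul_le_mul_of_nonneg_left ih (sub_nonneg.2 (hρ c).2)
    have h2 := mul_nonneg (hρ c).1 (Finset.sum_nonneg fun c' (_ : c' ∈ s) => (hρ c').1)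
    linarith

/-- The weights of the outcomes in which at most one bit is set, for independent bits. -/
theorem bitsLaw_singleton_ge {ι : Type*} [Fintype ι] [DecidableEq ι] (β : ι → I) (ρ : ι → ℝ)
    (hρ : ∀ c, ρ c ∈ Set.Icc 0 1) (hρβ : ∀ c, 1 - ρ c ≤ β c) (hβρ : ∀ c, (1 + ρ c) * β c ≤ 1) :
    ENNReal.ofReal (1 - ∑ c, ρ c) ≤ bitsLaw β {fun _ => false} ∧
    ∀ c, ENNReal.ofReal (1 - ∑ c, ρ c) * ENNReal.ofReal (ρ c) ≤
      bitsLaw β {fun c' => decide (c = c')} := by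
  have hprod : 1 - ∑ c, ρ c ≤ ∏ c, (β c : ℝ) :=
    calc 1 - ∑ c, ρ c ≤ ∏ c, (1 - ρ c) := one_sub_sum_le_prod_one_sub _ _ hρ
      _ ≤ ∏ c, (β c : ℝ) := Finset.prod_le_prod (fun c _ => by linarith [(hρ c).2]) fun c _ => hρβ c
  constructor
  · rw [bitsLaw, Measure.pi_singleton]
    simp_rw [bernoulliMeasure_false_singleton]
    rw [← ENNReal.ofReal_prod_of_nonneg fun c _ => (β c).2.1]
    exact ENNReal.ofReal_le_ofReal hprod
  · intro c
    have h0 : 0 ≤ ∏ c' ∈ Finset.univ.erase c, (β c' : ℝ) :=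
      Finset.prod_nonneg fun c' _ => (β c').2.1
    rw [bitsLaw, Measure.pi_singleton, ← Finset.mul_prod_erase _ _ (Finset.mem_univ c)]
    have : ∏ c' ∈ Finset.univ.erase c, bernoulliMeasure false true (β c') {decide (c = c')} =
        ∏ c' ∈ Finset.univ.erase c, ENNReal.ofReal (β c') := by
      refine Finset.prod_congr rfl fun c' hc' => ?_
      rw [decide_eq_false (Finset.ne_of_mem_erase hc').symm, bernoulliMeasure_false_singleton]
    rw [this, decide_eq_true rfl, bernoulliMeasure_true_singleton,
      ← ENNReal.ofReal_prod_of_nonneg fun c _ => (β c).2.1,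
      ← ENNReal.ofReal_mul' (hρ c).1, ← ENNReal.ofReal_mul (sub_nonneg.2 (β c).2.2)]
    refine ENNReal.ofReal_le_ofReal ?_
    calc (1 - ∑ c, ρ c) * ρ c ≤ (∏ c, (β c : ℝ)) * ρ c :=
          mul_le_mul_of_nonneg_right hprod (hρ c).1
      _ = (ρ c * β c) * ∏ c' ∈ Finset.univ.erase c, (β c' : ℝ) := by
          rw [← Finset.mul_prod_erase _ _ (Finset.mem_univ c)]
          ring
      -- `(1 + ρ) β ≤ 1` says that `ρ β ≤ 1 - β`.
      _ ≤ (1 - β c) * ∏ c' ∈ Finset.univ.erase c, (β c' : ℝ) := by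
          refine mul_le_mul_of_nonneg_right ?_ h0
          linarith [hβρ c]

/-- The bit vector that one item with hash value `c` produces on the cells of `W`. -/
def cellBits {B : ℕ} (W : Finset (Cell B)) (c : Cell B) : W → Bool := fun c' => decide (c = c')

theorem cellBits_clearOn {B : ℕ} (W : Finset (Cell B)) (A : Finset W) :
    cellBits W ⁻¹' clearOn A = {c | c ∉ A.map (Function.Embedding.subtype _)} := by
  ext c
  simp only [cellBits, clearOn, Set.mem_preimage, Set.mem_ofPred_eq, Finset.mem_map,
    Function.Embedding.subtype_apply, decide_eq_false_iff_not]
  grind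

/-- One item and independent bits with nearly the same means give nearly the same bit vectors. -/
theorem tvLe_map_cellBits {B : ℕ} [NeZero B] (W : Finset (Cell B)) (β : W → I)
    (hρβ : ∀ c, 1 - cellProb c.1 ≤ β c) (hβρ : ∀ c, (1 + cellProb c.1) * β c ≤ 1) :
    TVLe ((hashLaw B).map (cellBits W)) (bitsLaw β) (hashLaw B W ^ 2) := by
  classical
  obtain ⟨h0, h1⟩ := bitsLaw_singleton_ge β (fun c => cellProb c.1) (fun c => cellProb_mem c.1)
    hρβ hβρ
  have hm : Measurable (cellBits W) := measurable_of_countable _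
  have hW : (hashLaw B).real W = ∑ c : W, cellProb c.1 := by
    rw [Finset.sum_coe_sort W (fun c => cellProb c), ← sum_measureReal_singleton]
    exact Finset.sum_congr rfl fun c _ => hashLaw_real_singleton c
  have hq : ENNReal.ofReal (1 - ∑ c : W, cellProb c.1) = hashLaw B (W : Set (Cell B))ᶜ := by
    rw [← hW, ← probReal_compl_eq_one_sub W.measurableSet, ofReal_measureReal]
  have hρ (c : Cell B) : ENNReal.ofReal (cellProb c) = hashLaw B {c} := by
    rw [← hashLaw_real_singleton, ofReal_measureReal]
  rw [hq] at h0 h1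
  -- With `p = hashLaw B W`, the outcome of a single bit at `c` has weight `ρ` for one item and at
  -- least `(1 - p) ρ` for independent bits, an excess of at most `p ρ`. The zero vector has no
  -- excess. Summing over `c` gives `p ^ 2`.
  have key (x : W → Bool) : (hashLaw B).map (cellBits W) {x} ≤ bitsLaw β {x} +
      (hashLaw B W • ((hashLaw B).restrict W).map (cellBits W)) {x} := by
    rw [Measure.smul_apply, Measure.map_apply hm (measurableSet_singleton x),
      Measure.map_apply hm (measurableSet_singleton x),
      Measure.restrict_apply (hm (measurableSet_singleton x)), smul_eq_mul]
    by_cases hx : ∃ c : W, cellBits W c = x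
    · obtain ⟨c, rfl⟩ := hx
      have hpre : cellBits W ⁻¹' {cellBits W c} = {c.1} := by
        ext d
        simp only [Set.mem_preimage, Set.mem_singleton_iff]
        refine ⟨fun h => ?_, fun h => by rw [h]⟩
        have := congrFun h c
        simpa [cellBits] using this
      have hc : (fun c' : W => decide (c = c')) = cellBits W c := by
        funext c'
        exact decide_eq_decide.2 Subtype.ext_iff
      have h1c := h1 c
      rw [hρ, hc] at h1c
      have hcW : ({c.1} : Set (Cell B)) ∩ W = {c.1} := by simp
      rw [hpre, hcW]
      calc hashLaw B {c.1} = (hashLaw B (W : Set (Cell B))ᶜ + hashLaw B W) * hashLaw B {c.1} := by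
            rw [add_comm, measure_add_measure_compl W.measurableSet, measure_univ, one_mul]
        _ ≤ _ := by
            rw [add_mul]
            gcongr
    · have hdisj : cellBits W ⁻¹' {x} ⊆ (W : Set (Cell B))ᶜ :=
        fun c hc hcW => hx ⟨⟨c, hcW⟩, hc⟩
      refine le_add_right ?_
      by_cases hx0 : x = fun _ => false
      · rw [hx0]
        exact (measure_mono (hx0 ▸ hdisj)).trans h0
      · have : cellBits W ⁻¹' {x} = ∅ := by
          refine Set.eq_empty_of_forall_notMem fun c hc => hx0 ?_
          rw [← (hc : cellBits W c = x)]
          ext c'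
          have : c ≠ c'.1 := fun h => hdisj hc (h ▸ c'.2)
          simp [cellBits, this]
        simp [this]
  intro A _
  have hA : A = ((A.toFinite.toFinset : Finset (W → Bool)) : Set (W → Bool)) := by simp
  calc (hashLaw B).map (cellBits W) A
      ≤ (bitsLaw β + hashLaw B W • ((hashLaw B).restrict W).map (cellBits W)) A := by
        rw [hA, ← sum_measure_singleton, ← sum_measure_singleton]
        exact Finset.sum_le_sum fun x _ => key x
    _ ≤ bitsLaw β A + hashLaw B W * ((hashLaw B).restrict W).map (cellBits W) Set.univ := by
        rw [Measure.add_apply, Measure.smul_apply, smul_eq_mul]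
        gcongr
        exact Set.subset_univ A
    _ = bitsLaw β A + hashLaw B W ^ 2 := by
        rw [Measure.map_apply hm MeasurableSet.univ, Set.preimage_univ, Measure.restrict_apply_univ,
          sq]

/-! ### Vanishing probabilities of the three laws -/

theorem hashLaw_compl_finset {B : ℕ} [NeZero B] (A : Finset (Cell B)) :
    hashLaw B {c | c ∉ A} = ENNReal.ofReal (1 - ∑ c ∈ A, cellProb c) := by
  have : ({c | c ∉ A} : Set (Cell B)) = (A : Set (Cell B))ᶜ := rfl
  rw [this, ← ofReal_measureReal, probReal_compl_eq_one_sub A.measurableSet,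
    ← sum_measureReal_singleton]
  simp_rw [hashLaw_real_singleton]

theorem pcsaLaw_clearOn {B : ℕ} [NeZero B] (n : ℕ) (A : Finset (Cell B)) :
    pcsaLaw B n (clearOn A) = hashLaw B {c | c ∉ A} ^ n := by
  have : pcsa ⁻¹' clearOn A = Set.univ.pi fun _ : Fin n => {c | c ∉ A} := by
    ext h
    simp only [pcsa, clearOn, Set.mem_preimage, Set.mem_ofPred_eq, Set.mem_univ_pi,
      decide_eq_false_iff_not, not_exists]
    grind
  rw [pcsaLaw, Measure.map_apply measurable_pcsa (measurableSet_clearOn A), this, Measure.pi_pi]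
  simp

/-- The Poisson generating function `E r ^ N = exp (-n (1 - r))` turns the sum of cell probabilities
in `1 - r` into a product over cells. -/
theorem poissonPcsaLaw_clearOn {B : ℕ} [NeZero B] (n : ℕ) (A : Finset (Cell B)) :
    poissonPcsaLaw B n (clearOn A) = ∏ c ∈ A, ENNReal.ofReal (Real.exp (-cellProb c)) ^ n := by
  have hr0 : 0 ≤ 1 - ∑ c ∈ A, cellProb c := by
    have h : ∑ c ∈ A, cellProb c = (hashLaw B).real A := by
      rw [← sum_measureReal_singleton]
      simp_rw [hashLaw_real_singleton]
    rw [h, sub_nonneg]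
    exact measureReal_le_one
  rw [poissonPcsaLaw, Measure.bind_apply (measurableSet_clearOn A)
    (measurable_of_countable _).aemeasurable]
  simp_rw [pcsaLaw_clearOn, hashLaw_compl_finset]
  rw [Finset.prod_pow, ← ENNReal.ofReal_prod_of_nonneg fun c _ => (Real.exp_pos _).le,
    ← Real.exp_sum, Finset.sum_neg_distrib]
  set r := 1 - ∑ c ∈ A, cellProb c with hr
  have hr' : ∑ c ∈ A, cellProb c = 1 - r := by rw [hr]; ring
  rw [hr', poissonMeasure, lintegral_sum_measure]
  simp_rw [lintegral_smul_measure, lintegral_dirac, smul_eq_mul]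
  have hs : HasSum (fun m : ℕ => Real.exp (-n) * n ^ m / m.factorial * r ^ m)
      (Real.exp (-(1 - r)) ^ n) := by
    have := (NormedSpace.expSeries_div_hasSum_exp ((n : ℝ) * r)).mul_left (Real.exp (-n))
    rw [← Real.exp_eq_exp_ℝ, ← Real.exp_add] at this
    have e (m : ℕ) : Real.exp (-n) * n ^ m / m.factorial * r ^ m =
        Real.exp (-n) * ((n * r) ^ m / m.factorial) := by rw [mul_pow]; ring
    have e' : (n : ℝ) * -(1 - r) = -n + n * r := by ring
    simp_rw [e]
    rw [← Real.exp_nat_mul, e']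
    exact this
  have hnn (m : ℕ) : 0 ≤ Real.exp (-n) * n ^ m / m.factorial * r ^ m := by positivity
  rw [← ENNReal.ofReal_pow (Real.exp_pos _).le, ← hs.tsum_eq,
    ENNReal.ofReal_tsum_of_nonneg hnn hs.summable]
  refine tsum_congr fun m => ?_
  rw [ENNReal.ofReal_mul (by positivity), ENNReal.ofReal_pow hr0]
  simp

theorem compositeLaw_clearOn {B : ℕ} [NeZero B] (n : ℕ) (A : Finset (Cell B)) :
    compositeLaw B n (clearOn A) = ∏ c ∈ A, ENNReal.ofReal (1 - cellProb c) ^ n := by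
  rw [compositeLaw, clearOn_eq_pi, Measure.infinitePi_pi _ fun _ _ => measurableSet_singleton _]
  refine Finset.prod_congr rfl fun c _ => ?_
  rw [Measure.map_apply (measurable_pi_apply c) (measurableSet_singleton _)]
  have : (fun s : Sketch B => s c) ⁻¹' {false} = clearOn {c} := by
    ext s
    simp [clearOn]
  rw [this, pcsaLaw_clearOn, hashLaw_compl_finset, Finset.sum_singleton]

theorem map_restrict_clearOn {ι : Type*} (μ : Measure (ι → Bool)) (W : Finset ι) (A : Finset W) :
    μ.map W.restrict (clearOn A) = μ (clearOn (A.map (Function.Embedding.subtype _))) := by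
  rw [Measure.map_apply (Finset.measurable_restrict W) (measurableSet_clearOn A)]
  congr 1
  ext s
  simp [clearOn]

theorem map_restrict_pcsaLaw {B : ℕ} [NeZero B] (n : ℕ) (W : Finset (Cell B)) :
    (pcsaLaw B n).map W.restrict = orLaw n ((hashLaw B).map (cellBits W)) := by
  have hm : Measurable (cellBits W) := measurable_of_countable _
  have := Measure.isProbabilityMeasure_map (μ := hashLaw B) hm.aemeasurable
  have := Measure.isProbabilityMeasure_map (μ := pcsaLaw B n)
    (Finset.measurable_restrict W).aemeasurable
  refine ext_of_clearOn fun A => ?_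
  rw [map_restrict_clearOn, pcsaLaw_clearOn, orLaw_clearOn,
    Measure.map_apply hm (measurableSet_clearOn A), cellBits_clearOn]

/-- The `n`-th powers split the law into `n` fictitious independent items, which can be compared
with the real ones item by item. -/
theorem map_restrict_eq_orLaw_bitsLaw {ι : Type*} (n : ℕ) (μ : Measure (ι → Bool))
    [IsProbabilityMeasure μ] (β : ι → I)
    (hμ : ∀ A, μ (clearOn A) = ∏ c ∈ A, ENNReal.ofReal (β c) ^ n) (W : Finset ι) :
    μ.map W.restrict = orLaw n (bitsLaw fun c : W => β c) := by
  have := Measure.isProbabilityMeasure_map (μ := μ) (Finset.measurable_restrict W).aemeasurable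
  refine ext_of_clearOn fun A => ?_
  rw [map_restrict_clearOn, hμ, orLaw_clearOn, bitsLaw_clearOn, Finset.prod_map, Finset.prod_pow]
  rfl

/-! ### Reduction to a finite window of levels -/

/-- On `G` the map `f` is injective and loses no information; outside `G` both measures are small.
-/
theorem TVLe.of_map {X Y : Type*} [MeasurableSpace X] [MeasurableSpace Y] [Countable Y]
    [MeasurableSingletonClass Y] {μ ν : Measure X} {ε δ δ' : ℝ≥0∞} {f : X → Y} (hf : Measurable f)
    {G : Set X} (hG : Set.InjOn f G) (h : TVLe (μ.map f) (ν.map f) ε) (hμ : μ Gᶜ ≤ δ)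
    (hν : ν Gᶜ ≤ δ') : TVLe μ ν (ε + δ + δ') := by
  intro A _
  have hm : MeasurableSet (f '' (A ∩ G)) := (Set.to_countable _).measurableSet
  have hA := h _ hm
  rw [Measure.map_apply hf hm, Measure.map_apply hf hm] at hA
  have h1 : A ⊆ f ⁻¹' (f '' (A ∩ G)) ∪ Gᶜ := fun x hx => by
    by_cases hxG : x ∈ G
    · exact Or.inl ⟨x, ⟨hx, hxG⟩, rfl⟩
    · exact Or.inr hxG
  have h2 : f ⁻¹' (f '' (A ∩ G)) ⊆ A ∪ Gᶜ := by
    rintro x ⟨y, ⟨hyA, hyG⟩, hyx⟩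
    by_cases hxG : x ∈ G
    · exact Or.inl (hG hyG hxG hyx ▸ hyA)
    · exact Or.inr hxG
  calc μ A ≤ μ (f ⁻¹' (f '' (A ∩ G))) + μ Gᶜ := (measure_mono h1).trans (measure_union_le _ _)
    _ ≤ (ν (f ⁻¹' (f '' (A ∩ G))) + ε) + δ := by gcongr
    _ ≤ ((ν A + ν Gᶜ) + ε) + δ := by
        gcongr
        exact (measure_mono h2).trans (measure_union_le _ _)
    _ ≤ ((ν A + δ') + ε) + δ := by gcongr
    _ = ν A + (ε + δ + δ') := by ring

/-- The cells with levels in `[j₀, j₁)`. -/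
def levelCells (B j₀ j₁ : ℕ) : Finset (Cell B) := Finset.univ ×ˢ Finset.Ico j₀ j₁

theorem mem_levelCells {B j₀ j₁ : ℕ} {c : Cell B} :
    c ∈ levelCells B j₀ j₁ ↔ j₀ ≤ c.2 ∧ c.2 < j₁ := by
  simp [levelCells]

/-- The sketches with all levels below `j₀` full and all levels from `j₁` on empty. -/
def fullThenEmpty (B j₀ j₁ : ℕ) : Set (Sketch B) :=
  {s | (∀ c, c.2 < j₀ → s c = true) ∧ ∀ c, j₁ ≤ c.2 → s c = false}

theorem injOn_restrict_fullThenEmpty (B j₀ j₁ : ℕ) :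
    Set.InjOn (levelCells B j₀ j₁).restrict (fullThenEmpty B j₀ j₁) := by
  intro s hs t ht hst
  funext c
  by_cases h0 : c.2 < j₀
  · rw [hs.1 c h0, ht.1 c h0]
  by_cases h1 : j₁ ≤ c.2
  · rw [hs.2 c h1, ht.2 c h1]
  · exact congrFun hst ⟨c, mem_levelCells.2 ⟨not_lt.1 h0, not_le.1 h1⟩⟩

theorem sum_cellProb_levelCells {B : ℕ} [NeZero B] (j₀ j₁ : ℕ) (h : j₀ ≤ j₁) :
    ∑ c ∈ levelCells B j₀ j₁, cellProb c = (2 : ℝ)⁻¹ ^ j₀ - (2 : ℝ)⁻¹ ^ j₁ := by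
  have hB : (B : ℝ) ≠ 0 := NeZero.ne _
  simp only [levelCells, Finset.sum_product, cellProb, Finset.sum_const, Finset.card_univ,
    Fintype.card_fin, nsmul_eq_mul]
  rw [← Finset.sum_div, mul_div_cancel₀ _ hB]
  induction j₁, h using Nat.le_induction with
  | base => simp
  | succ j hj ih =>
    rw [Finset.sum_Ico_succ_top hj, ih]
    ring

theorem hashLaw_levelCells_le {B : ℕ} [NeZero B] (j₀ j₁ : ℕ) :
    hashLaw B (levelCells B j₀ j₁) ≤ ENNReal.ofReal ((2 : ℝ)⁻¹ ^ j₀) := by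
  rcases le_total j₀ j₁ with h | h
  · rw [← ofReal_measureReal, ← sum_measureReal_singleton]
    simp_rw [hashLaw_real_singleton]
    rw [sum_cellProb_levelCells _ _ h]
    exact ENNReal.ofReal_le_ofReal (sub_le_self _ (by positivity))
  · simp [levelCells, h]

/-- Since `2 ^ i ≥ 1 + i` and `x ≥ 1`, the terms are dominated by a geometric series of ratio `exp
(-1) ≤ 1 / 2`. -/
theorem sum_exp_neg_mul_two_pow_le {x : ℝ} (hx : 1 ≤ x) (j : ℕ) :
    ∑ i ∈ Finset.range j, Real.exp (-(x * 2 ^ i)) ≤ 2 * Real.exp (-x) := by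
  have hexp : Real.exp (-1) ≤ 1 / 2 := by
    rw [Real.exp_neg, ← one_div]
    exact one_div_le_one_div_of_le (by norm_num) (by linarith [Real.add_one_le_exp 1])
  calc ∑ i ∈ Finset.range j, Real.exp (-(x * 2 ^ i))
      ≤ ∑ i ∈ Finset.range j, Real.exp (-x) * (1 / 2) ^ i := by
        refine Finset.sum_le_sum fun i _ => ?_
        have h2 : (1 : ℝ) + i * 1 ≤ 2 ^ i := by
          have := one_add_mul_le_pow (a := (1 : ℝ)) (by norm_num) i
          norm_num at this ⊢
          exact this
        have hi : (0 : ℝ) ≤ i := i.cast_nonneg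
        calc Real.exp (-(x * 2 ^ i)) ≤ Real.exp (-x + i * (-1)) := by
              refine Real.exp_le_exp.2 ?_
              nlinarith
          _ = Real.exp (-x) * Real.exp (-1) ^ i := by rw [Real.exp_add, Real.exp_nat_mul]
          _ ≤ Real.exp (-x) * (1 / 2) ^ i := by gcongr
    _ = Real.exp (-x) * ∑ i ∈ Finset.range j, (1 / 2 : ℝ) ^ i := by rw [Finset.mul_sum]
    _ ≤ Real.exp (-x) * 2 := by
        gcongr
        exact sum_geometric_two_le j
    _ = 2 * Real.exp (-x) := mul_comm _ _

/-- A cell at level `j - 1 - i` has `n ρ = x 2 ^ i`, so the sum is dominated by the levels just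
below `j`. -/
theorem sum_exp_neg_cellProb_le {B : ℕ} [NeZero B] (n j : ℕ) {x : ℝ} (hx : 1 ≤ x)
    (hxj : x = n * (2 : ℝ)⁻¹ ^ j / B) :
    ∑ c ∈ levelCells B 0 j, Real.exp (-cellProb c) ^ n ≤ 2 * B * Real.exp (-x) := by
  simp only [levelCells, Finset.sum_product, cellProb, Finset.sum_const, Finset.card_univ,
    Fintype.card_fin, nsmul_eq_mul]
  rw [mul_comm 2 (B : ℝ), mul_assoc]
  refine mul_le_mul_of_nonneg_left ?_ (Nat.cast_nonneg _)
  refine le_trans (le_of_eq ?_) (sum_exp_neg_mul_two_pow_le hx j)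
  rw [← Finset.sum_range_reflect, ← Finset.range_eq_Ico]
  refine Finset.sum_congr rfl fun k hk => ?_
  rw [← Real.exp_nat_mul, hxj]
  congr 1
  have hk' := Finset.mem_range.1 hk
  obtain ⟨i, rfl⟩ : ∃ i, j = k + 1 + i := ⟨j - 1 - k, by omega⟩
  have : k + 1 + i - 1 - k = i := by omega
  rw [this, pow_add _ (k + 1) i, inv_pow 2 i]
  field_simp

/-- A union bound needing only single-cell marginals, hence valid for both laws under comparison. A
low cell is clear with probability at most `exp (-ρ) ^ n`; a high one is set with probability at
most `1 - (1 - ρ) ^ n ≤ n ρ`. -/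
theorem measure_compl_fullThenEmpty_le {B : ℕ} [NeZero B] (n j₀ j₁ : ℕ)
    (ν : Measure (Sketch B)) [IsProbabilityMeasure ν] (b : Cell B → I)
    (hb : ∀ c, ν (clearOn {c}) = ENNReal.ofReal (b c) ^ n) (h1 : ∀ c, 1 - cellProb c ≤ b c)
    (h2 : ∀ c, b c ≤ Real.exp (-cellProb c)) :
    ν (fullThenEmpty B j₀ j₁)ᶜ ≤
      ENNReal.ofReal (∑ c ∈ levelCells B 0 j₀, Real.exp (-cellProb c) ^ n) +
      n * hashLaw B {c | j₁ ≤ c.2} := by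
  have hsub : (fullThenEmpty B j₀ j₁)ᶜ ⊆ (⋃ c ∈ levelCells B 0 j₀, clearOn {c}) ∪
      ⋃ c : {c : Cell B | j₁ ≤ c.2}, (clearOn {c.1})ᶜ := by
    intro s hs
    by_contra hns
    simp only [Set.mem_union, Set.mem_iUnion, not_or, not_exists, mem_levelCells, clearOn,
      Set.mem_compl_iff, Finset.mem_singleton, forall_eq, Set.mem_ofPred_eq,
      Bool.not_eq_false] at hns
    exact hs ⟨fun c hc => hns.1 c ⟨Nat.zero_le _, hc⟩, fun c hc =>
      Bool.eq_false_of_not_eq_true (hns.2 ⟨c, hc⟩)⟩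
  refine (measure_mono hsub).trans ((measure_union_le _ _).trans (add_le_add ?_ ?_))
  · refine (measure_biUnion_finset_le _ _).trans ?_
    rw [ENNReal.ofReal_sum_of_nonneg fun c _ => by positivity]
    refine Finset.sum_le_sum fun c _ => ?_
    rw [hb, ENNReal.ofReal_pow (Real.exp_pos _).le]
    gcongr
    exact h2 c
  · refine (measure_iUnion_le _).trans ?_
    have hc (c : Cell B) : ν (clearOn {c})ᶜ ≤ n * hashLaw B {c} := by
      rw [prob_compl_eq_one_sub (measurableSet_clearOn _), hb, ← ENNReal.ofReal_pow (b c).2.1,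
        ← ENNReal.ofReal_one, ← ENNReal.ofReal_sub _ (pow_nonneg (b c).2.1 n),
        ← ofReal_measureReal (μ := hashLaw B), hashLaw_real_singleton, ← ENNReal.ofReal_natCast,
        ← ENNReal.ofReal_mul (Nat.cast_nonneg n)]
      refine ENNReal.ofReal_le_ofReal ?_
      have hρ := cellProb_mem c
      have := one_add_mul_le_pow (a := -cellProb c) (by linarith [hρ.2]) n
      have h3 : (1 + -cellProb c) ^ n ≤ (b c : ℝ) ^ n :=
        pow_le_pow_left₀ (by linarith [hρ.2]) (by linarith [h1 c]) n
      linarith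
    refine (ENNReal.tsum_le_tsum fun c : {c : Cell B | j₁ ≤ c.2} => hc c.1).trans ?_
    rw [ENNReal.tsum_mul_left]
    gcongr
    rw [← measure_iUnion]
    · refine measure_mono ?_
      simp
    · intro c d hcd
      simpa [Subtype.ext_iff] using hcd
    · exact fun c => measurableSet_singleton _

theorem tendsto_hashLaw_high_levels (B : ℕ) [NeZero B] :
    Tendsto (fun j => hashLaw B {c | j ≤ c.2}) atTop (𝓝 0) := by
  have h : (⋂ j : ℕ, {c : Cell B | j ≤ c.2}) = ∅ := by
    refine Set.eq_empty_of_forall_notMem fun c hc => ?_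
    have := Set.mem_iInter.1 hc (c.2 + 1)
    simp at this
  rw [← measure_empty (μ := hashLaw B), ← h]
  refine tendsto_measure_iInter_atTop (fun j => (Set.to_countable _).measurableSet.nullMeasurableSet)
    (fun j k hjk c hc => le_trans hjk hc) ⟨0, measure_ne_top _ _⟩

/-! ### The total variation bound and the choice of the cut level -/

/-- A total variation bound between the summary of `n` items and independent bits with nearly the
same means; the levels below `j` are full with high probability. -/
theorem tvLe_pcsaLaw {B : ℕ} [NeZero B] (n j : ℕ) (μ : Measure (Sketch B))
    [IsProbabilityMeasure μ] (β : Cell B → I)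
    (hμ : ∀ A, μ (clearOn A) = ∏ c ∈ A, ENNReal.ofReal (β c) ^ n)
    (h1 : ∀ c, 1 - cellProb c ≤ β c) (h2 : ∀ c, β c ≤ Real.exp (-cellProb c)) {x : ℝ} (hx : 1 ≤ x)
    (hxj : x = n * (2 : ℝ)⁻¹ ^ j / B) {δ : ℝ} (hδ : 0 < δ) :
    TVLe (pcsaLaw B n) μ
      (ENNReal.ofReal (n * ((2 : ℝ)⁻¹ ^ j) ^ 2 + 4 * B * Real.exp (-x) + δ)) := by
  -- The upper cut only makes the window finite; it does not enter the bound beyond `δ / 2` for each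
  -- law.
  obtain ⟨j₁, hj₁⟩ : ∃ j₁, n * hashLaw B {c | j₁ ≤ c.2} ≤ ENNReal.ofReal (δ / 2) := by
    have := ENNReal.Tendsto.const_mul (a := (n : ℝ≥0∞)) (tendsto_hashLaw_high_levels B)
      (Or.inr (ENNReal.natCast_ne_top n))
    rw [mul_zero] at this
    exact (this.eventually_le_const (ENNReal.ofReal_pos.2 (half_pos hδ))).exists
  set W := levelCells B j j₁
  have hm : Measurable (cellBits W) := measurable_of_countable _
  have := Measure.isProbabilityMeasure_map (μ := hashLaw B) hm.aemeasurable
  have hmid : TVLe ((pcsaLaw B n).map W.restrict) (μ.map W.restrict)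
      (n * ENNReal.ofReal ((2 : ℝ)⁻¹ ^ j) ^ 2) := by
    rw [map_restrict_pcsaLaw, map_restrict_eq_orLaw_bitsLaw n μ β hμ]
    refine TVLe.map (TVLe.pi (TVLe.mono (tvLe_map_cellBits W _ (fun c => h1 c) fun c => ?_) ?_) n)
      measurable_bitOr
    · calc (1 + cellProb c.1) * β c.1 ≤ Real.exp (cellProb c.1) * Real.exp (-cellProb c.1) := by
            refine mul_le_mul ?_ (h2 c) (β c.1).2.1 (Real.exp_pos _).le
            linarith [Real.add_one_le_exp (cellProb c.1)]
        _ = 1 := by rw [← Real.exp_add, add_neg_cancel, Real.exp_zero]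
    · gcongr
      exact hashLaw_levelCells_le j j₁
  have hsum := ENNReal.ofReal_le_ofReal (sum_exp_neg_cellProb_le (B := B) n j hx hxj)
  have hbad : ∀ (ν : Measure (Sketch B)) [IsProbabilityMeasure ν] (b : Cell B → I),
      (∀ c, ν (clearOn {c}) = ENNReal.ofReal (b c) ^ n) → (∀ c, 1 - cellProb c ≤ b c) →
      (∀ c, b c ≤ Real.exp (-cellProb c)) →
      ν (fullThenEmpty B j j₁)ᶜ ≤
        ENNReal.ofReal (2 * B * Real.exp (-x)) + ENNReal.ofReal (δ / 2) :=
    fun ν _ b hb hb1 hb2 => (measure_compl_fullThenEmpty_le n j j₁ ν b hb hb1 hb2).trans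
      (add_le_add hsum hj₁)
  have hS := hbad (pcsaLaw B n) (fun c => unitInterval.symm ⟨cellProb c, cellProb_mem c⟩)
    (fun c => by
      rw [pcsaLaw_clearOn, hashLaw_compl_finset, Finset.sum_singleton]
      rfl)
    (fun c => le_rfl) (fun c => Real.one_sub_le_exp_neg _)
  have hμ' := hbad μ β (fun c => by rw [hμ, Finset.prod_singleton]) h1 h2
  refine (TVLe.of_map (Finset.measurable_restrict W) (injOn_restrict_fullThenEmpty B j j₁) hmid hS
    hμ').mono (le_of_eq ?_)
  rw [← ENNReal.ofReal_pow (by positivity), ← ENNReal.ofReal_natCast,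
    ← ENNReal.ofReal_mul (by positivity), ← ENNReal.ofReal_add (by positivity) (by positivity),
    ← ENNReal.ofReal_add (by positivity) (by positivity),
    ← ENNReal.ofReal_add (by positivity) (by positivity)]
  congr 1
  ring

theorem eventually_tvLe_pcsaLaw (B : ℕ → ℕ) [∀ n, NeZero (B n)]
    (hB : (fun n => (B n : ℝ) * Real.log (B n)) =o[atTop] (fun n : ℕ => Real.sqrt n))
    (μ : ∀ n, Measure (Sketch (B n))) [∀ n, IsProbabilityMeasure (μ n)] (β : ∀ n, Cell (B n) → I)
    (hμ : ∀ n A, μ n (clearOn A) = ∏ c ∈ A, ENNReal.ofReal (β n c) ^ n)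
    (h1 : ∀ n c, 1 - cellProb c ≤ β n c) (h2 : ∀ n c, β n c ≤ Real.exp (-cellProb c))
    {ε : ℝ} (hε : 0 < ε) :
    ∀ᶠ n in atTop, TVLe (pcsaLaw (B n) n) (μ n) (ENNReal.ofReal ε) := by
  have hBpos (n : ℕ) : (1 : ℝ) ≤ B n := by exact_mod_cast NeZero.one_le
  obtain ⟨M, hM1, hM⟩ : ∃ M : ℝ, 1 ≤ M ∧ 4 * Real.exp (-M) ≤ ε / 4 := by
    have : Tendsto (fun M : ℝ => 4 * Real.exp (-M)) atTop (𝓝 (4 * 0)) :=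
      Real.tendsto_exp_neg_atTop_nhds_zero.const_mul 4
    rw [mul_zero] at this
    exact ((eventually_ge_atTop 1).and
      (this.eventually_le_const (by positivity : 0 < ε / 4))).exists
  have hsqrt : Tendsto (fun n : ℕ => Real.sqrt n) atTop atTop :=
    Real.tendsto_sqrt_atTop.comp tendsto_natCast_atTop_atTop
  have hconst : (fun _ : ℕ => (3 : ℝ)) =o[atTop] (fun n : ℕ => Real.sqrt n) :=
    isLittleO_const_left.2 (Or.inr (tendsto_norm_atTop_atTop.comp hsqrt))
  -- `B ≤ B log B + 3`: the constant covers `B ≤ 3`, where `log B` may vanish, and otherwise `log B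
  -- ≥ 1`.
  have hB' : (fun n => (B n : ℝ)) =o[atTop] (fun n : ℕ => Real.sqrt n) := by
    refine (IsBigO.of_norm_le fun n => ?_).trans_isLittleO (hB.add hconst)
    have hlog := Real.log_nonneg (hBpos n)
    rw [Real.norm_of_nonneg (by positivity)]
    by_cases h3 : (B n : ℝ) ≤ 3
    · nlinarith [hBpos n]
    · have : 1 ≤ Real.log (B n) := by
        rw [Real.le_log_iff_exp_le (by linarith [hBpos n])]
        linarith [Real.exp_one_lt_three]
      nlinarith [hBpos n]
  have hy : (fun n => (B n : ℝ) * (Real.log (B n) + M)) =o[atTop] (fun n : ℕ => Real.sqrt n) := by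
    refine (hB.add (hB'.const_mul_left M)).congr_left fun n => ?_
    ring
  obtain ⟨η, hη0, hη1, hηε⟩ : ∃ η : ℝ, 0 < η ∧ η ≤ 1 ∧ 4 * η ^ 2 ≤ ε / 4 := by
    refine ⟨min 1 (ε / 16), by positivity, min_le_left _ _, ?_⟩
    have h0 : 0 < min 1 (ε / 16) := by positivity
    nlinarith [min_le_left 1 (ε / 16), min_le_right 1 (ε / 16)]
  filter_upwards [hy.bound hη0, eventually_ge_atTop 1] with n hn hn1
  have hlog := Real.log_nonneg (hBpos n)
  have hn1' : (1 : ℝ) ≤ n := by exact_mod_cast hn1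
  set y := Real.log (B n) + M with hyd
  have hy1 : 1 ≤ y := by linarith
  have hB0 : (0 : ℝ) < B n := by linarith [hBpos n]
  have hyB : 0 < B n * y := by positivity
  rw [Real.norm_of_nonneg hyB.le, Real.norm_of_nonneg (Real.sqrt_nonneg _)] at hn
  have hsq : (B n * y) ^ 2 ≤ η ^ 2 * n := by
    calc (B n * y) ^ 2 ≤ (η * Real.sqrt n) ^ 2 := pow_le_pow_left₀ hyB.le hn 2
      _ = η ^ 2 * n := by rw [mul_pow, Real.sq_sqrt (Nat.cast_nonneg n)]
  have hle : B n * y ≤ n := by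
    refine hn.trans ?_
    have h := Real.sqrt_le_self_iff.2 (Or.inr hn1')
    nlinarith [Real.sqrt_nonneg (n : ℝ)]
  -- `2 ^ j ≤ n / (B y) < 2 ^ (j + 1)`: the lower bound gives `x ≥ y`, the upper one `n 4⁻ʲ ≤ 4 (B
  -- y) ^ 2 / n ≤ 4 η ^ 2`.
  obtain ⟨j, hj, hj'⟩ := exists_nat_pow_near ((one_le_div hyB).2 hle) (one_lt_two (α := ℝ))
  rw [le_div_iff₀ hyB] at hj
  rw [div_lt_iff₀ hyB, pow_succ] at hj'
  have h2j : (0 : ℝ) < 2 ^ j := by positivity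
  have hx : y ≤ n * (2 : ℝ)⁻¹ ^ j / B n := by
    rw [inv_pow, ← div_eq_mul_inv, div_div, le_div_iff₀ (by positivity)]
    linarith
  refine (tvLe_pcsaLaw n j (μ n) (β n) (hμ n) (h1 n) (h2 n) (hy1.trans hx) rfl
    (by positivity : 0 < ε / 4)).mono (ENNReal.ofReal_le_ofReal ?_)
  have hp : (n : ℝ) * ((2 : ℝ)⁻¹ ^ j) ^ 2 ≤ ε / 4 := by
    refine le_trans ?_ hηε
    rw [inv_pow, inv_pow, ← div_eq_mul_inv, div_le_iff₀ (by positivity)]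
    have h3 : (n : ℝ) ^ 2 ≤ (2 ^ j * 2 * (B n * y)) ^ 2 :=
      pow_le_pow_left₀ (Nat.cast_nonneg n) hj'.le 2
    have h4 : (2 ^ j * 2 * (B n * y)) ^ 2 ≤ (2 ^ j * 2) ^ 2 * (η ^ 2 * n) := by
      rw [mul_pow]
      gcongr
    have h5 : (n : ℝ) * n ≤ (4 * η ^ 2 * (2 ^ j) ^ 2) * n := by nlinarith
    exact le_of_mul_le_mul_right h5 (by linarith)
  have he : 4 * (B n : ℝ) * Real.exp (-(n * (2 : ℝ)⁻¹ ^ j / B n)) ≤ ε / 4 := by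
    calc 4 * (B n : ℝ) * Real.exp (-(n * (2 : ℝ)⁻¹ ^ j / B n))
        ≤ 4 * (B n : ℝ) * Real.exp (-y) := by gcongr
      _ = 4 * Real.exp (-M) := by
          rw [hyd, neg_add, Real.exp_add, Real.exp_neg (Real.log _), Real.exp_log hB0]
          field_simp
      _ ≤ ε / 4 := hM
  linarith

theorem mainTheorem4 (B : ℕ → ℕ) [∀ n, NeZero (B n)]
    (hB : (fun n => (B n : ℝ) * Real.log (B n)) =o[atTop] (fun n : ℕ => Real.sqrt n))
    {Ω : Type u} [MeasurableSpace Ω] (P : Measure Ω) [IsProbabilityMeasure P]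
    (S : ∀ n, Ω → Sketch (B n)) (hS : ∀ n, HasLaw (S n) (pcsaLaw (B n) n) P) :
    ∃ (Ω' : Type u) (_ : MeasurableSpace Ω') (P' : Measure Ω') (_ : IsProbabilityMeasure P')
      (π : Ω' → Ω) (Sbar Stilde : ∀ n, Ω' → Sketch (B n)),
      MeasurePreserving π P' P ∧
      (∀ n, HasLaw (Sbar n) (poissonPcsaLaw (B n) n) P') ∧
      (∀ n, HasLaw (Stilde n) (compositeLaw (B n) n) P') ∧
      Tendsto (fun n => P' {ω | S n (π ω) = Stilde n ω ∧ Stilde n ω = Sbar n ω})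
        atTop (𝓝 1) := by
  have hpoisson {ε : ℝ} (hε : 0 < ε) :
      ∀ᶠ n in atTop, TVLe (pcsaLaw (B n) n) (poissonPcsaLaw (B n) n) (ENNReal.ofReal ε) :=
    eventually_tvLe_pcsaLaw B hB (fun n => poissonPcsaLaw (B n) n)
      (fun n c => ⟨Real.exp (-cellProb c), (Real.exp_pos _).le,
        Real.exp_le_one_iff.2 (neg_nonpos.2 (cellProb_mem c).1)⟩)
      (fun n A => poissonPcsaLaw_clearOn n A) (fun n c => Real.one_sub_le_exp_neg _)
      (fun n c => le_rfl) hε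
  have hcomposite {ε : ℝ} (hε : 0 < ε) :
      ∀ᶠ n in atTop, TVLe (pcsaLaw (B n) n) (compositeLaw (B n) n) (ENNReal.ofReal ε) :=
    eventually_tvLe_pcsaLaw B hB (fun n => compositeLaw (B n) n)
      (fun n c => unitInterval.symm ⟨cellProb c, cellProb_mem c⟩)
      (fun n A => compositeLaw_clearOn n A) (fun n c => le_rfl)
      (fun n c => Real.one_sub_le_exp_neg _) hε
  -- The Boolean selects the target law, so one enlargement serves both families and all `n`.
  have hprob (i : ℕ × Bool) : IsProbabilityMeasure
      (if i.2 then poissonPcsaLaw (B i.1) i.1 else compositeLaw (B i.1) i.1) := by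
    split <;> infer_instance
  obtain ⟨Ω', m', P', hP', π, T, hπ, hT, hST⟩ := exists_enlarged_coupling
    (ι := ℕ × Bool) (X := fun i => Sketch (B i.1)) P (fun i => pcsaLaw (B i.1) i.1)
    (fun i => if i.2 then poissonPcsaLaw (B i.1) i.1 else compositeLaw (B i.1) i.1)
    (fun i => S i.1) (fun i => hS i.1)
  refine ⟨Ω', m', P', hP', π, fun n => T (n, true), fun n => T (n, false), hπ,
    fun n => by simpa using hT (n, true), fun n => by simpa using hT (n, false), ?_⟩
  refine tendsto_order.2 ⟨fun a ha => ?_, fun a ha => .of_forall fun n => prob_le_one.trans_lt ha⟩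
  obtain ⟨ε, hε, hεa⟩ : ∃ ε : ℝ, 0 < ε ∧ a + (ENNReal.ofReal ε + ENNReal.ofReal ε) < 1 := by
    have ha' : a ≠ ∞ := ne_top_of_lt ha
    have ha1 : a.toReal < 1 := by simpa using (ENNReal.toReal_lt_toReal ha' (by simp)).2 ha
    refine ⟨(1 - a.toReal) / 4, by linarith, ?_⟩
    have har := ENNReal.ofReal_toReal ha'
    set r := a.toReal with hr
    rw [← har, ← ENNReal.ofReal_add (by linarith) (by linarith),
      ← ENNReal.ofReal_add (hr ▸ ENNReal.toReal_nonneg) (by linarith), ENNReal.ofReal_lt_one]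
    linarith
  filter_upwards [hpoisson hε, hcomposite hε] with n hn1 hn2
  have e1 := hST (n, true) (ENNReal.ofReal ε) (by simpa using hn1)
  have e2 := hST (n, false) (ENNReal.ofReal ε) (by simpa using hn2)
  by_contra! hlt
  -- Each target is coupled to `S n` separately; a union bound over the two disagreements handles
  -- the triple equality.
  have hcover : (Set.univ : Set Ω') ⊆
      {ω | S n (π ω) = T (n, false) ω ∧ T (n, false) ω = T (n, true) ω} ∪
      ({ω | S n (π ω) ≠ T (n, true) ω} ∪ {ω | S n (π ω) ≠ T (n, false) ω}) := by
    intro ω _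
    by_cases hω1 : S n (π ω) = T (n, true) ω
    · by_cases hω2 : S n (π ω) = T (n, false) ω
      · exact Or.inl ⟨hω2, hω2.symm.trans hω1⟩
      · exact Or.inr (Or.inr hω2)
    · exact Or.inr (Or.inl hω1)
  refine absurd hεa (not_lt.2 ?_)
  calc (1 : ℝ≥0∞) = P' Set.univ := measure_univ.symm
    _ ≤ _ := (measure_mono hcover).trans (measure_union_le _ _)
    _ ≤ a + (ENNReal.ofReal ε + ENNReal.ofReal ε) :=
        add_le_add hlt ((measure_union_le _ _).trans (add_le_add e1 e2))
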